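/- Let $0<R\le\infty$, $I=[0,R)$, and $f:I\to\mathbb{R}$. For a real matrix $A=(a_{ij})$ with entries in $I$ write $f[A]=(f(a_{ij}))$, and let $\mathbf 1_{n\times n}$ be the $n\times n$ matrix with all entries $1$. For an interval $J$ with interior $J^\circ$, $f$ is called absolutely monotonic on $J$ if $f$ is continuous on $J$, $f\in C^\infty(J^\circ)$, and $f^{(k)}(x)\ge 0$ for all $x\in J^\circ$ and all integers $k\ge 0$. Positive semidefinite matrices are real symmetric. Then the following are equivalent: (a) For all $n\ge 1$, $f[a\mathbf 1_{n\times n}+uu^T]$ is positive semidefinite for every $a\in I$ and every $u\in[0,\sqrt{R-a})^n$ (with $\sqrt{\infty}=\infty$). (b) $f$ is absolutely monotonic on $(0,R)$, the limit $f^+(0):=\lim_{x\to 0^+}f(x)$ exists in $\mathbb{R}$, and $0\le f(0)\le f^+(0)$. Similarly, the following are equivalent: (1) $f$ is right-continuous at $0$ and condition (a) holds. (2) For all $n\ge 1$, $f[A]$ is positive semidefinite for every positive semidefinite $n\times n$ matrix $A$ with entries in $I$. (3) $f$ is absolutely monotonic on $I$. -/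

import Mathlib

open Set Filter Topology Matrix
open scoped ContDiff

/-- The real interval `[0, R)`, where the right endpoint `R` may be `∞`. -/
def intervalCO (R : EReal) : Set ℝ := {x : ℝ | 0 ≤ x ∧ (x : EReal) < R}

/-- The real interval `(0, R)`, where the right endpoint `R` may be `∞`. -/
def intervalOO (R : EReal) : Set ℝ := {x : ℝ | 0 < x ∧ (x : EReal) < R}

/-- `f` is absolutely monotonic on the interval `I`: it is continuous on `I`, smooth on the
interior of `I`, and all its derivatives (the zeroth one included) are nonnegative on the interior.
(On an open set this agrees with Mathlib's `AbsolutelyMonotoneOn`; on `[0, R)` nothing but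
continuity is asked at the endpoint.) -/
def AbsMonotonicOn (f : ℝ → ℝ) (I : Set ℝ) : Prop :=
  ContinuousOn f I ∧ ContDiffOn ℝ ∞ f (interior I) ∧
    ∀ k : ℕ, ∀ x ∈ interior I, 0 ≤ iteratedDeriv k f x

/-- The matrix `a 𝟏ₙₓₙ + u uᵀ`. -/
def specialMatrix {n : ℕ} (a : ℝ) (u : Fin n → ℝ) : Matrix (Fin n) (Fin n) ℝ :=
  a • Matrix.of (fun _ _ => (1 : ℝ)) + Matrix.vecMulVec u u

/-- For all `n ≥ 1`, the entrywise image `f[a 𝟏ₙₓₙ + u uᵀ]` is positive semidefinite for every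
`a ∈ [0, R)` and every `u ∈ [0, √(R - a))ⁿ`. The condition `uᵢ < √(R - a)` is written as
`a + uᵢ ^ 2 < R`, which also makes sense for `R = ∞`. -/
def PreservesSpecial (R : EReal) (f : ℝ → ℝ) : Prop :=
  ∀ n : ℕ, 1 ≤ n → ∀ a ∈ intervalCO R, ∀ u : Fin n → ℝ,
    (∀ i, 0 ≤ u i ∧ ((a + u i ^ 2 : ℝ) : EReal) < R) →
      ((specialMatrix a u).map f).PosSemidef

/-- For all `n ≥ 1`, the entrywise image `f[A]` is positive semidefinite for every positive
semidefinite real `n × n` matrix `A` with entries in `I`. -/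
def PreservesPSD (I : Set ℝ) (f : ℝ → ℝ) : Prop :=
  ∀ n : ℕ, 1 ≤ n → ∀ A : Matrix (Fin n) (Fin n) ℝ,
    A.PosSemidef → (∀ i j, A i j ∈ I) → (A.map f).PosSemidef

/-! Rank-one perturbations already force absolute monotonicity. For smooth `f`, take `u i = √t * i`
and test the form of `f (a + t * i * j)` against binomial finite-difference weights: as `t → 0+` it
is `m! * f⁽ᵐ⁾(a) * t ^ m + o(t ^ m)`, so every derivative is nonnegative
(`iteratedDeriv_nonneg_of_forms`). For general `f`, the 2×2 cases give continuity on `(0, R)`.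
Mollification averages over shifts of `a` and so keeps the forms nonnegative; by Bernstein the
mollified functions are power series with nonnegative coefficients, and such series are closed under
pointwise limits (`HasNonnegSeriesOn.of_tendsto`). Hence `f` is smooth.

Conversely, the Taylor series of `f` at a small `ε > 0` has nonnegative coefficients, Schur's
product theorem handles each power, and `ε → 0` gives positivity. A jump at `0` survives on the
special matrices because the zeros of `u uᵀ` are the complement of a block; a 3×3 matrix with a
different zero pattern excludes it for general positive semidefinite matrices. -/

theorem posSemidef_iff_sum {n : ℕ} (A : Matrix (Fin n) (Fin n) ℝ) :
    A.PosSemidef ↔ (∀ i j, A i j = A j i) ∧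
      ∀ v : Fin n → ℝ, 0 ≤ ∑ i, ∑ j, v i * v j * A i j := by
  rw [Matrix.posSemidef_iff_dotProduct_mulVec]
  refine and_congr ?_ (forall_congr' fun v => ?_)
  · rw [Matrix.IsHermitian.ext_iff]
    simp only [star_trivial]
    exact forall_comm
  · have : star v ⬝ᵥ A *ᵥ v = ∑ i, ∑ j, v i * v j * A i j := by
      simp only [dotProduct, mulVec, star_trivial, Finset.mul_sum]
      exact Finset.sum_congr rfl fun i _ => Finset.sum_congr rfl fun j _ => by ring
    rw [this]

/-! ### Taylor series of absolutely monotone functions -/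

/-- The Cauchy form of the remainder is chosen because its factor `(x - ξ) ^ n`, compared with `(c -
ξ) ^ n` for `c > x`, decays geometrically uniformly in `ξ`. -/
theorem exists_cauchy_remainder_eq {f : ℝ → ℝ} {p q b x : ℝ}
    (hf : ContDiffOn ℝ ∞ f (Ioo p q)) (hpb : p < b) (hbx : b < x) (hxq : x < q) (n : ℕ) :
    ∃ ξ ∈ Ioo b x, f x - ∑ k ∈ Finset.range (n + 1),
        iteratedDeriv k f b / k.factorial * (x - b) ^ k =
      iteratedDeriv (n + 1) f ξ * (x - ξ) ^ n / n.factorial * (x - b) := by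
  have hsub : Icc b x ⊆ Ioo p q := fun y hy => ⟨hpb.trans_le hy.1, hy.2.trans_lt hxq⟩
  have hat : ∀ y ∈ Icc b x, ∀ k : ℕ, ContDiffAt ℝ k f y := fun y hy k =>
    (hf.contDiffAt (isOpen_Ioo.mem_nhds (hsub hy))).of_le (by exact_mod_cast le_top)
  have hcd : ∀ k : ℕ, ContDiffOn ℝ k f (Icc b x) := fun k =>
    (hf.mono hsub).of_le (by exact_mod_cast le_top)
  have hU := uniqueDiffOn_Icc hbx
  have heq : ∀ y ∈ Icc b x, ∀ k, iteratedDerivWithin k f (Icc b x) y = iteratedDeriv k f y :=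
    fun y hy k => iteratedDerivWithin_eq_iteratedDeriv hU (hat y hy k) hy
  obtain ⟨ξ, hξ, h⟩ := taylor_mean_remainder_cauchy (n := n) hbx.ne
    (by rw [uIcc_of_le hbx.le]; exact hcd n)
    (by
      rw [uIcc_of_le hbx.le, uIoo_of_le hbx.le]
      exact ((hcd (n + 1)).differentiableOn_iteratedDerivWithin
        (by exact_mod_cast Nat.lt_succ_self n) hU).mono Ioo_subset_Icc_self)
  rw [uIcc_of_le hbx.le] at h
  rw [uIoo_of_le hbx.le] at hξ
  refine ⟨ξ, hξ, ?_⟩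
  rw [heq ξ (Ioo_subset_Icc_self hξ), taylor_within_apply] at h
  rw [← h]
  congr 1
  refine Finset.sum_congr rfl fun k _ => ?_
  rw [heq b (left_mem_Icc.2 hbx.le), smul_eq_mul]
  ring

theorem taylor_sum_le {f : ℝ → ℝ} {p q b x : ℝ} (hf : ContDiffOn ℝ ∞ f (Ioo p q))
    (hpos : ∀ k, ∀ y ∈ Ioo p q, 0 ≤ iteratedDeriv k f y)
    (hpb : p < b) (hbx : b < x) (hxq : x < q) (n : ℕ) :
    ∑ k ∈ Finset.range (n + 1), iteratedDeriv k f b / k.factorial * (x - b) ^ k ≤ f x := by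
  obtain ⟨ξ, hξ, h⟩ := exists_cauchy_remainder_eq hf hpb hbx hxq n
  have h1 := hpos (n + 1) ξ ⟨hpb.trans hξ.1, hξ.2.trans hxq⟩
  have h2 : 0 ≤ x - ξ := sub_nonneg.2 hξ.2.le
  have h3 : 0 ≤ x - b := sub_nonneg.2 hbx.le
  have : 0 ≤ iteratedDeriv (n + 1) f ξ * (x - ξ) ^ n / n.factorial * (x - b) := by positivity
  linarith

/-- Bernstein: the Taylor series of an absolutely monotone function converges to it on the right
of the base point. -/
theorem hasSum_taylor_of_nonneg {f : ℝ → ℝ} {p q b x : ℝ} (hf : ContDiffOn ℝ ∞ f (Ioo p q))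
    (hpos : ∀ k, ∀ y ∈ Ioo p q, 0 ≤ iteratedDeriv k f y)
    (hpb : p < b) (hbx : b ≤ x) (hxq : x < q) :
    HasSum (fun k : ℕ => iteratedDeriv k f b / k.factorial * (x - b) ^ k) (f x) := by
  rcases hbx.eq_or_lt with rfl | hbx
  · convert! hasSum_single (α := ℝ) 0 fun k hk => ?_ using 1
    · simp
    · simp [hk]
  obtain ⟨c, hxc, hcq⟩ := exists_between hxq
  have hb : b ∈ Ioo p q := ⟨hpb, hbx.trans hxq⟩
  have hnn : ∀ k : ℕ, 0 ≤ iteratedDeriv k f b / k.factorial * (x - b) ^ k := fun k => by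
    have := hpos k b hb
    have h3 : 0 ≤ x - b := sub_nonneg.2 hbx.le
    positivity
  rw [hasSum_iff_tendsto_nat_of_nonneg hnn, ← tendsto_add_atTop_iff_nat 1]
  have hcb : 0 < c - b := by linarith
  have hcx : 0 < c - x := by linarith
  have hxb : 0 < x - b := by linarith
  set r := (x - b) / (c - b) with hr
  have hr0 : 0 ≤ r := by positivity
  have hr1 : r < 1 := by rw [hr, div_lt_one hcb]; linarith
  have hfc : 0 ≤ f c := by simpa using hpos 0 c ⟨by linarith, hcq⟩
  have hlim : Tendsto (fun n : ℕ => f c * (x - b) / (c - x) * (n * r ^ n + r ^ n)) atTop (𝓝 0) := by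
    simpa using ((tendsto_self_mul_const_pow_of_lt_one hr0 hr1).add
      (tendsto_pow_atTop_nhds_zero_of_lt_one hr0 hr1)).const_mul (f c * (x - b) / (c - x))
  have key : ∀ n : ℕ, f x - ∑ k ∈ Finset.range (n + 1),
      iteratedDeriv k f b / k.factorial * (x - b) ^ k ≤
        f c * (x - b) / (c - x) * (n * r ^ n + r ^ n) := by
    intro n
    obtain ⟨ξ, hξ, h⟩ := exists_cauchy_remainder_eq hf hpb hbx hxq n
    have hξ' : ξ ∈ Ioo p q := ⟨hpb.trans hξ.1, hξ.2.trans hxq⟩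
    have hcξ : 0 < c - ξ := by linarith [hξ.2]
    have hxξ : 0 ≤ x - ξ := by linarith [hξ.2]
    -- A single term of the Taylor sum at `ξ`, evaluated at `c`, is at most `f c` since all terms
    -- are nonnegative.
    have hD : iteratedDeriv (n + 1) f ξ / (n + 1).factorial * (c - ξ) ^ (n + 1) ≤ f c := by
      refine le_trans ?_ (taylor_sum_le hf hpos hξ'.1 (hξ.2.trans hxc) hcq (n + 1))
      refine Finset.single_le_sum (f := fun k : ℕ =>
        iteratedDeriv k f ξ / k.factorial * (c - ξ) ^ k) (fun k _ => ?_) (by simp)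
      have := hpos k ξ hξ'
      positivity
    -- For `x < c` the ratio decreases in `ξ`, so it is largest at `ξ = b`.
    have hratio : (x - ξ) / (c - ξ) ≤ r := by
      rw [hr, div_le_div_iff₀ hcξ hcb]
      nlinarith [hξ.1, hξ.2]
    have hq0 : 0 ≤ (x - ξ) / (c - ξ) := by positivity
    rw [h]
    calc iteratedDeriv (n + 1) f ξ * (x - ξ) ^ n / n.factorial * (x - b)
        = (iteratedDeriv (n + 1) f ξ / (n + 1).factorial * (c - ξ) ^ (n + 1)) *
            ((n + 1) * (x - b) / (c - ξ) * ((x - ξ) / (c - ξ)) ^ n) := by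
          rw [Nat.factorial_succ, div_pow]
          push_cast
          field_simp
          ring
      _ ≤ f c * ((n + 1) * (x - b) / (c - x) * r ^ n) := by
          gcongr
          exact hξ.2.le
      _ = _ := by ring
  refine tendsto_of_tendsto_of_tendsto_of_le_of_le (g := fun n : ℕ =>
    f x - f c * (x - b) / (c - x) * (n * r ^ n + r ^ n)) ?_ tendsto_const_nhds
    (fun n => ?_) (fun n => taylor_sum_le hf hpos hpb hbx hxq n)
  · simpa using hlim.const_sub (f x)
  · have := key n
    simp only
    linarith

/-! ### Derivatives from quadratic forms -/

/-- This is the `m`-th forward difference of `x ^ k` at `0`. -/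
theorem sum_binomial_mul_pow (m k : ℕ) (hk : k ≤ m) :
    ∑ i : Fin (m + 1), ((-1 : ℝ) ^ (m - (i : ℕ)) * (m.choose i)) * (i : ℝ) ^ k =
      if k = m then (m.factorial : ℝ) else 0 := by
  have h := fwdDiff_iter_eq_sum_shift (1 : ℝ) (fun x : ℝ => x ^ k) m 0
  rw [Fin.sum_univ_eq_sum_range
    (fun i : ℕ => ((-1 : ℝ) ^ (m - i) * (m.choose i)) * (i : ℝ) ^ k) (m + 1)]
  have h2 : ∑ i ∈ Finset.range (m + 1), ((-1 : ℝ) ^ (m - i) * (m.choose i)) * (i : ℝ) ^ k =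
      (fwdDiff (1 : ℝ))^[m] (fun x : ℝ => x ^ k) 0 := by
    rw [h]
    refine Finset.sum_congr rfl fun i _ => ?_
    simp
  rw [h2]
  split_ifs with hkm
  · subst hkm
    simp [fwdDiff_iter_eq_factorial]
  · rw [fwdDiff_iter_pow_eq_zero_of_lt (lt_of_le_of_ne hk hkm)]
    rfl

/-- Nonnegativity of the quadratic forms of `g (a + t i j)` for small `t > 0` forces
nonnegativity of the derivatives of `g` at `a`. -/
theorem iteratedDeriv_nonneg_of_forms {g : ℝ → ℝ} {a : ℝ} {m : ℕ} (hg : ContDiffAt ℝ ∞ g a)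
    (h : ∀ v : Fin (m + 1) → ℝ, ∀ᶠ t in 𝓝[>] (0 : ℝ),
      0 ≤ ∑ i, ∑ j, v i * v j * g (a + t * ((i : ℕ) * (j : ℕ)))) :
    0 ≤ iteratedDeriv m g a := by
  obtain ⟨U, hU, hgU⟩ := (hg.of_le (m := m) (by exact_mod_cast le_top)).contDiffOn le_rfl (by simp)
  obtain ⟨η, hη, hball⟩ := Metric.mem_nhds_iff.1 hU
  have hs : a ∈ Metric.ball a η := Metric.mem_ball_self hη
  have hT := taylor_isLittleO (convex_ball a η) hs (hgU.mono hball)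
  rw [Metric.isOpen_ball.nhdsWithin_eq hs] at hT
  set v : Fin (m + 1) → ℝ := fun i => (-1 : ℝ) ^ (m - (i : ℕ)) * (m.choose i) with hv
  set P : ℝ → ℝ := taylorWithinEval g m (Metric.ball a η) a with hP
  have hPs : ∀ s, P (a + s) = ∑ k ∈ Finset.range (m + 1),
      iteratedDeriv k g a / k.factorial * s ^ k := by
    intro s
    rw [hP, taylor_within_apply]
    refine Finset.sum_congr rfl fun k _ => ?_
    rw [iteratedDerivWithin_of_isOpen Metric.isOpen_ball hs]
    simp only [add_sub_cancel_left, smul_eq_mul]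
    ring
  have hform : ∀ t : ℝ, ∑ i, ∑ j, v i * v j * P (a + t * ((i : ℕ) * (j : ℕ))) =
      iteratedDeriv m g a * m.factorial * t ^ m := by
    intro t
    -- Since `(t * i * j) ^ k` factors in `i` and `j`, each Taylor monomial contributes a square of
    -- an `m`-th difference; only `k = m` survives.
    have h1 : ∑ i, ∑ j, v i * v j * P (a + t * ((i : ℕ) * (j : ℕ))) =
        ∑ k ∈ Finset.range (m + 1), iteratedDeriv k g a / k.factorial * t ^ k *
          (∑ i, v i * ((i : ℕ) : ℝ) ^ k) ^ 2 := by
      have : ∀ k, (∑ i, v i * ((i : ℕ) : ℝ) ^ k) ^ 2 =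
          ∑ i, ∑ j, (v i * ((i : ℕ) : ℝ) ^ k) * (v j * ((j : ℕ) : ℝ) ^ k) := fun k => by
        rw [sq, Finset.sum_mul_sum]
      simp only [this, hPs, Finset.mul_sum]
      rw [Finset.sum_comm' (t' := Finset.univ) (s' := fun _ => Finset.range (m + 1)) (by simp)]
      refine Finset.sum_congr rfl fun i _ => ?_
      rw [Finset.sum_comm]
      refine Finset.sum_congr rfl fun j _ => Finset.sum_congr rfl fun k _ => ?_
      rw [mul_pow, mul_pow]
      ring
    rw [h1, Finset.sum_eq_single m]
    · rw [sum_binomial_mul_pow m m le_rfl, if_pos rfl]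
      have : (m.factorial : ℝ) ≠ 0 := by positivity
      field_simp
    · intro k hk hkm
      rw [sum_binomial_mul_pow m k (by simpa [Nat.lt_succ_iff] using hk), if_neg hkm]
      simp
    · simp
  have hlim : Tendsto (fun t : ℝ => (∑ i, ∑ j, v i * v j * g (a + t * ((i : ℕ) * (j : ℕ)))) / t ^ m)
      (𝓝[>] 0) (𝓝 (iteratedDeriv m g a * m.factorial)) := by
    have hterm : ∀ i j : Fin (m + 1), Tendsto (fun t : ℝ =>
        (g (a + t * ((i : ℕ) * (j : ℕ))) - P (a + t * ((i : ℕ) * (j : ℕ)))) / t ^ m)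
        (𝓝[>] 0) (𝓝 0) := by
      intro i j
      have hta : Tendsto (fun t : ℝ => a + t * ((i : ℕ) * (j : ℕ))) (𝓝[>] 0) (𝓝 a) := by
        have : Continuous fun t : ℝ => a + t * (((i : ℕ) : ℝ) * (j : ℕ)) := by fun_prop
        exact (this.tendsto' 0 a (by simp)).mono_left nhdsWithin_le_nhds
      have h2 := hT.comp_tendsto hta
      have h3 : (fun t : ℝ => (g (a + t * ((i : ℕ) * (j : ℕ))) - P (a + t * ((i : ℕ) * (j : ℕ)))))
          =o[𝓝[>] 0] fun t : ℝ => t ^ m := by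
        refine h2.trans_isBigO ?_
        refine Asymptotics.IsBigO.of_bound ((((i : ℕ) : ℝ) * (j : ℕ)) ^ m) (Eventually.of_forall ?_)
        intro t
        simp only [Function.comp, add_sub_cancel_left, mul_pow t, norm_mul]
        rw [mul_comm, Real.norm_of_nonneg (by positivity)]
      exact h3.tendsto_div_nhds_zero
    have hsum : Tendsto (fun t : ℝ => ∑ i, ∑ j, v i * v j *
        ((g (a + t * ((i : ℕ) * (j : ℕ))) - P (a + t * ((i : ℕ) * (j : ℕ)))) / t ^ m))
        (𝓝[>] 0) (𝓝 (∑ i : Fin (m + 1), ∑ j : Fin (m + 1), v i * v j * 0)) :=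
      tendsto_finsetSum _ fun i _ => tendsto_finsetSum _ fun j _ => (hterm i j).const_mul _
    simp only [mul_zero, Finset.sum_const_zero] at hsum
    have hadd := hsum.const_add (iteratedDeriv m g a * m.factorial)
    rw [add_zero] at hadd
    refine hadd.congr' ?_
    filter_upwards [self_mem_nhdsWithin] with t ht
    have htm : t ^ m ≠ 0 := pow_ne_zero _ (ne_of_gt ht)
    rw [eq_div_iff htm, add_mul, ← hform t, Finset.sum_mul, ← Finset.sum_add_distrib]
    refine Finset.sum_congr rfl fun i _ => ?_
    rw [Finset.sum_mul, ← Finset.sum_add_distrib]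
    refine Finset.sum_congr rfl fun j _ => ?_
    field_simp
    ring
  have hnn : 0 ≤ iteratedDeriv m g a * m.factorial := by
    refine ge_of_tendsto hlim ?_
    filter_upwards [h v, self_mem_nhdsWithin] with t ht ht0
    exact div_nonneg ht (pow_nonneg (le_of_lt ht0) m)
  exact nonneg_of_mul_nonneg_left hnn (by positivity)

/-! ### Limits of power series with nonnegative coefficients -/

/-- `f` is given on `[b, q)` by a power series at `b` with nonnegative coefficients. -/
def HasNonnegSeriesOn (f : ℝ → ℝ) (b q : ℝ) : Prop :=
  ∃ c : ℕ → ℝ, (∀ k, 0 ≤ c k) ∧ ∀ x ∈ Ico b q, HasSum (fun k => c k * (x - b) ^ k) (f x)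

/-- Nonnegativity bounds each term at `y` by the whole sum, hence eventually by `f y + 1`. The
coefficients therefore have limit points, and comparison with a geometric series passes the limit
through the sum. -/
theorem HasNonnegSeriesOn.of_tendsto {f : ℝ → ℝ} {F : ℕ → ℝ → ℝ} {b q : ℝ}
    (hF : ∀ᶠ n in atTop, HasNonnegSeriesOn (F n) b q)
    (hlim : ∀ x ∈ Ico b q, Tendsto (fun n => F n x) atTop (𝓝 (f x))) :
    HasNonnegSeriesOn f b q := by
  classical
  let c : ℕ → ℕ → ℝ := fun n => if h : HasNonnegSeriesOn (F n) b q then h.choose else 0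
  have hc : ∀ᶠ n in atTop, (∀ k, 0 ≤ c n k) ∧
      ∀ x ∈ Ico b q, HasSum (fun k => c n k * (x - b) ^ k) (F n x) := by
    filter_upwards [hF] with n hn
    simpa only [c, dif_pos hn] using hn.choose_spec
  -- Limits along a free ultrafilter converge for all coefficients at once, replacing a diagonal
  -- subsequence.
  let u : Ultrafilter ℕ := hyperfilter ℕ
  have hu : (u : Filter ℕ) ≤ atTop := by
    rw [← Nat.cofinite_eq_atTop]; exact hyperfilter_le_cofinite
  have hbound : ∀ y ∈ Ioo b q, ∀ᶠ n in (u : Filter ℕ), ∀ k,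
      0 ≤ c n k ∧ c n k * (y - b) ^ k ≤ f y + 1 := by
    intro y hy
    have h1 : ∀ᶠ n in atTop, F n y < f y + 1 :=
      (hlim y (Ioo_subset_Ico_self hy)).eventually_lt_const (by linarith)
    refine hu ?_
    filter_upwards [hc, h1] with n hn hn1 k
    refine ⟨hn.1 k, (le_hasSum (hn.2 y (Ioo_subset_Ico_self hy)) k fun j _ => ?_).trans hn1.le⟩
    exact mul_nonneg (hn.1 j) (pow_nonneg (by linarith [hy.1]) j)
  rcases le_or_gt q b with hqb | hbq
  · exact ⟨0, fun _ => le_rfl, fun x hx => absurd (hx.1.trans_lt hx.2) hqb.not_gt⟩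
  have hex : ∀ k, ∃ l : ℝ, 0 ≤ l ∧ Tendsto (fun n => c n k) u (𝓝 l) := by
    intro k
    obtain ⟨y, hy⟩ := exists_between hbq
    have hyb : 0 < y - b := by linarith [hy.1]
    have hmem : ∀ᶠ n in (u : Filter ℕ), c n k ∈ Icc 0 ((f y + 1) / (y - b) ^ k) := by
      filter_upwards [hbound y hy] with n hn
      exact ⟨(hn k).1, (le_div_iff₀ (by positivity)).2 (hn k).2⟩
    obtain ⟨l, hl, hle⟩ := isCompact_Icc.ultrafilter_le_nhds (u.map fun n => c n k)
      (by rw [le_principal_iff]; exact hmem)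
    exact ⟨l, hl.1, hle⟩
  choose l hl0 hl using hex
  refine ⟨l, hl0, fun x hx => ?_⟩
  obtain ⟨y, hxy, hyq⟩ := exists_between hx.2
  have hy : y ∈ Ioo b q := ⟨hx.1.trans_lt hxy, hyq⟩
  have hyb : 0 < y - b := by linarith [hy.1]
  have hxb : 0 ≤ x - b := by linarith [hx.1]
  have hr0 : 0 ≤ (x - b) / (y - b) := by positivity
  have hr1 : (x - b) / (y - b) < 1 := by rw [div_lt_one hyb]; linarith
  have hsum : Summable fun k : ℕ => (f y + 1) * ((x - b) / (y - b)) ^ k :=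
    (summable_geometric_of_lt_one hr0 hr1).mul_left _
  have hdom : ∀ᶠ n in (u : Filter ℕ), ∀ k,
      ‖c n k * (x - b) ^ k‖ ≤ (f y + 1) * ((x - b) / (y - b)) ^ k := by
    filter_upwards [hbound y hy] with n hn k
    have hck := (hn k).1
    rw [Real.norm_of_nonneg (by positivity), div_pow]
    calc c n k * (x - b) ^ k = (c n k * (y - b) ^ k) * ((x - b) ^ k / (y - b) ^ k) := by
          field_simp
      _ ≤ (f y + 1) * ((x - b) ^ k / (y - b) ^ k) := by
          gcongr
          exact (hn k).2
  have hpt : ∀ k, Tendsto (fun n => c n k * (x - b) ^ k) u (𝓝 (l k * (x - b) ^ k)) :=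
    fun k => (hl k).mul_const _
  have htsum := tendsto_tsum_of_dominated_convergence hsum hpt hdom
  have hfx : Tendsto (fun n => ∑' k, c n k * (x - b) ^ k) u (𝓝 (f x)) := by
    refine ((hlim x hx).mono_left hu).congr' ?_
    filter_upwards [hu hc] with n hn
    exact (hn.2 x hx).tsum_eq.symm
  rw [tendsto_nhds_unique hfx htsum]
  refine Summable.hasSum (Summable.of_norm_bounded hsum fun k => ?_)
  exact le_of_tendsto (hpt k).norm (hdom.mono fun n hn => hn k)

theorem HasNonnegSeriesOn.contDiffAt {f : ℝ → ℝ} {b q x : ℝ} (hf : HasNonnegSeriesOn f b q)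
    (hx : x ∈ Ioo b q) : ContDiffAt ℝ ∞ f x := by
  obtain ⟨c, hc, hs⟩ := hf
  let p := FormalMultilinearSeries.ofScalars ℝ c
  obtain ⟨y, hxy, hyq⟩ := exists_between hx.2
  have hyb : 0 < y - b := by linarith [hx.1]
  have hrad : ENNReal.ofReal (y - b) ≤ p.radius := by
    refine p.le_radius_of_summable_norm (r := (y - b).toNNReal) ?_
    simp only [p, FormalMultilinearSeries.ofScalars_norm]
    rw [Real.coe_toNNReal _ hyb.le]
    refine (hs y ⟨by linarith, hyq⟩).summable.congr fun k => ?_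
    rw [Real.norm_of_nonneg (hc k)]
  have hpos : 0 < p.radius := (ENNReal.ofReal_pos.2 hyb).trans_le hrad
  have hmem : x - b ∈ Metric.eball (0 : ℝ) p.radius := by
    refine Metric.eball_subset_eball hrad ?_
    rw [Metric.mem_eball, edist_dist, Real.dist_eq, sub_zero, abs_of_pos (by linarith [hx.1])]
    exact (ENNReal.ofReal_lt_ofReal_iff hyb).2 (by linarith)
  have han : AnalyticAt ℝ p.sum (x - b) := (p.hasFPowerSeriesOnBall hpos).analyticAt_of_mem hmem
  have h1 : ContDiffAt ℝ ∞ (fun z => p.sum (z - b)) x :=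
    ContDiffAt.comp (g := p.sum) x han.contDiffAt (contDiffAt_id.sub contDiffAt_const)
  refine h1.congr_of_eventuallyEq ?_
  filter_upwards [isOpen_Ioo.mem_nhds hx] with z hz
  rw [← (hs z (Ioo_subset_Ico_self hz)).tsum_eq]
  have := FormalMultilinearSeries.ofScalars_sum_eq (E := ℝ) c (z - b)
  simpa [FormalMultilinearSeries.ofScalarsSum, smul_eq_mul] using this.symm

/-! ### Monotonicity and continuity from 2×2 matrices -/

section PreservesSpecial

variable {R : EReal} {f : ℝ → ℝ}

theorem specialMatrix_apply {n : ℕ} (a : ℝ) (u : Fin n → ℝ) (i j : Fin n) :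
    specialMatrix a u i j = a + u i * u j := by
  simp [specialMatrix, vecMulVec_apply]

theorem PreservesSpecial.sum_nonneg (h : PreservesSpecial R f) {n : ℕ} {a : ℝ} (ha : 0 ≤ a)
    {u : Fin n → ℝ} (hu : ∀ i, 0 ≤ u i ∧ ((a + u i ^ 2 : ℝ) : EReal) < R) (v : Fin n → ℝ) :
    0 ≤ ∑ i, ∑ j, v i * v j * f (a + u i * u j) := by
  rcases n with _ | n
  · simp
  have haR : (a : EReal) < R :=
    lt_of_le_of_lt (by exact_mod_cast le_add_of_nonneg_right (sq_nonneg _)) (hu 0).2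
  have := ((posSemidef_iff_sum _).1 (h (n + 1) (by omega) a ⟨ha, haR⟩ u hu)).2 v
  simpa only [Matrix.map_apply, specialMatrix_apply] using this

theorem PreservesSpecial.nonneg (h : PreservesSpecial R f) {x : ℝ} (hx : x ∈ intervalCO R) :
    0 ≤ f x := by
  have := h.sum_nonneg (n := 1) hx.1 (u := fun _ => 0) (fun _ => ⟨le_rfl, by simpa using hx.2⟩)
    (fun _ => 1)
  simpa using this

/-- With `a = x` and `u = (0, √(y - x))` the matrix is `[[x, x], [x, y]]`, and the vector `(-1, 1)`
gives `f y - f x`. -/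
theorem PreservesSpecial.monotoneOn (h : PreservesSpecial R f) :
    MonotoneOn f (intervalCO R) := by
  intro x hx y hy hxy
  have hs : √(y - x) ^ 2 = y - x := Real.sq_sqrt (by linarith)
  have := h.sum_nonneg (n := 2) hx.1 (u := ![0, √(y - x)])
    (fun i => by
      fin_cases i
      · simpa using hx.2
      · simp only [Fin.mk_one, Matrix.cons_val_one, Matrix.cons_val_fin_one, hs]
        simpa [Real.sqrt_nonneg] using hy.2)
    ![-1, 1]
  simp only [Fin.sum_univ_two, Matrix.cons_val_zero, Matrix.cons_val_one, ← sq, hs] at this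
  simp at this
  linarith

theorem PreservesSpecial.sq_le_mul (h : PreservesSpecial R f) {s t : ℝ} (hs : 0 ≤ s)
    (ht : 0 ≤ t) (hs2 : ((s ^ 2 : ℝ) : EReal) < R) (ht2 : ((t ^ 2 : ℝ) : EReal) < R) :
    f (s * t) ^ 2 ≤ f (s ^ 2) * f (t ^ 2) := by
  have key : ∀ x y : ℝ, 0 ≤ x ^ 2 * f (s ^ 2) + 2 * x * y * f (s * t) + y ^ 2 * f (t ^ 2) := by
    intro x y
    have := h.sum_nonneg (n := 2) le_rfl (u := ![s, t])
      (fun i => by fin_cases i <;> simp_all) ![x, y]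
    simp only [Fin.sum_univ_two, Matrix.cons_val_zero, Matrix.cons_val_one, zero_add] at this
    rw [mul_comm t s] at this
    ring_nf at this ⊢
    linarith
  have hd := discrim_le_zero (a := f (s ^ 2)) (b := 2 * f (s * t)) (c := f (t ^ 2))
    (fun x => by have := key x 1; ring_nf at this ⊢; linarith)
  rw [discrim] at hd
  nlinarith

/-- Monotonicity provides one-sided limits `l ≤ f x ≤ r`. For `τ > 1`, `x * τ` is the geometric mean
of `x / τ ^ 2 < x` and `x * τ ^ 4 > x`; `sq_le_mul` then yields `r ^ 2 ≤ l * r` as `τ → 1+`, which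
rules out a jump. -/
theorem PreservesSpecial.continuousAt (h : PreservesSpecial R f) {x : ℝ}
    (hx : x ∈ intervalOO R) : ContinuousAt f x := by
  obtain ⟨q, hxq, hqR⟩ := EReal.lt_iff_exists_real_btwn.1 hx.2
  have hxq : x < q := by exact_mod_cast hxq
  have hx0 : 0 < x := hx.1
  have hmem : ∀ y, 0 ≤ y → y < q → y ∈ intervalCO R := fun y h0 hy =>
    ⟨h0, lt_trans (by exact_mod_cast hy) hqR⟩
  have hmono : MonotoneOn f (Ioo 0 q) := h.monotoneOn.mono fun y hy => hmem y hy.1.le hy.2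
  have hxmem : x ∈ Ioo 0 q := ⟨hx0, hxq⟩
  have hleft := (hmono.mono (Ioo_subset_Ioo_right hxq.le)).tendsto_nhdsWithin_Ioo_left
    (nonempty_Ioo.2 hx0) ⟨f x, by
      rintro _ ⟨y, hy, rfl⟩
      exact hmono ⟨hy.1, hy.2.trans hxq⟩ hxmem hy.2.le⟩
  have hright := (hmono.mono (Ioo_subset_Ioo_left hx0.le)).tendsto_nhdsWithin_Ioo_right
    (nonempty_Ioo.2 hxq) ⟨f x, by
      rintro _ ⟨y, hy, rfl⟩
      exact hmono hxmem ⟨hx0.trans hy.1, hy.2⟩ hy.1.le⟩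
  set l := sSup (f '' Ioo 0 x)
  set r := sInf (f '' Ioo x q)
  have hlx : l ≤ f x := le_of_tendsto hleft (by
    filter_upwards [Ioo_mem_nhdsLT hx0] with y hy
    exact hmono ⟨hy.1, hy.2.trans hxq⟩ hxmem hy.2.le)
  have hxr : f x ≤ r := ge_of_tendsto hright (by
    filter_upwards [Ioo_mem_nhdsGT hxq] with y hy
    exact hmono hxmem ⟨hx0.trans hy.1, hy.2⟩ hy.1.le)
  have hl0 : 0 ≤ l := ge_of_tendsto hleft (by
    filter_upwards [Ioo_mem_nhdsLT hx0] with y hy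
    exact h.nonneg (hmem y hy.1.le (hy.2.trans hxq)))
  have hsx : 0 < √x := Real.sqrt_pos.2 hx0
  have hss : √x * √x = x := Real.mul_self_sqrt hx0.le
  have hrl : r ^ 2 ≤ l * r := by
    have hc : ∀ φ : ℝ → ℝ, Continuous φ → φ 1 = x → Tendsto φ (𝓝[>] 1) (𝓝 x) :=
      fun φ hφ h1 => (hφ.tendsto' 1 x h1).mono_left nhdsWithin_le_nhds
    have htR : Tendsto (fun τ : ℝ => x * τ) (𝓝[>] 1) (𝓝[>] x) := by
      refine tendsto_nhdsWithin_iff.2 ⟨hc _ (by fun_prop) (by ring), ?_⟩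
      filter_upwards [self_mem_nhdsWithin] with τ hτ
      exact lt_mul_of_one_lt_right hx0 hτ
    have htR2 : Tendsto (fun τ : ℝ => x * τ ^ 4) (𝓝[>] 1) (𝓝[>] x) := by
      refine tendsto_nhdsWithin_iff.2 ⟨hc _ (by fun_prop) (by ring), ?_⟩
      filter_upwards [self_mem_nhdsWithin] with τ hτ
      exact lt_mul_of_one_lt_right hx0 (one_lt_pow₀ hτ (by norm_num))
    have htL : Tendsto (fun τ : ℝ => x / τ ^ 2) (𝓝[>] 1) (𝓝[<] x) := by
      refine tendsto_nhdsWithin_iff.2 ⟨?_, ?_⟩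
      · have : ContinuousAt (fun τ : ℝ => x / τ ^ 2) 1 := by fun_prop (disch := norm_num)
        have h2 := this.tendsto
        simp only [one_pow, div_one] at h2
        exact h2.mono_left nhdsWithin_le_nhds
      · filter_upwards [self_mem_nhdsWithin] with τ hτ
        exact div_lt_self hx0 (one_lt_pow₀ hτ (by norm_num))
    refine le_of_tendsto_of_tendsto ((hright.comp htR).pow 2)
      ((hleft.comp htL).mul (hright.comp htR2)) ?_
    filter_upwards [htR2.eventually (Ioo_mem_nhdsGT hxq), self_mem_nhdsWithin] with τ hτ hτ1
    have hτ0 : (0 : ℝ) < τ := lt_trans one_pos hτ1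
    have hsq : √x ^ 2 = x := Real.sq_sqrt hx0.le
    have e1 : (√x / τ) ^ 2 = x / τ ^ 2 := by rw [div_pow, hsq]
    have e2 : (√x * τ ^ 2) ^ 2 = x * τ ^ 4 := by rw [mul_pow, hsq]; ring
    have e3 : √x / τ * (√x * τ ^ 2) = x * τ := by
      field_simp
      rw [hsq]
    have := h.sq_le_mul (s := √x / τ) (t := √x * τ ^ 2) (by positivity) (by positivity)
      (by
        rw [e1]
        exact (hmem _ (by positivity)
          ((div_lt_self hx0 (one_lt_pow₀ hτ1 (by norm_num))).trans hxq)).2)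
      (by rw [e2]; exact (hmem _ (by positivity) hτ.2).2)
    simpa only [Function.comp, e1, e2, e3] using this
  have hrl' : r ≤ l := by
    rcases (hl0.trans (hlx.trans hxr)).eq_or_lt with h0 | h0
    · rw [← h0]; exact hl0
    · rw [sq] at hrl
      exact le_of_mul_le_mul_right hrl h0
  have e1 : l = f x := le_antisymm hlx (hxr.trans hrl')
  have e2 : r = f x := le_antisymm (hrl'.trans hlx) hxr
  rw [e1] at hleft
  rw [e2] at hright
  exact continuousAt_iff_continuous_left'_right'.2 ⟨hleft, hright⟩

end PreservesSpecial

/-! ### Smoothness by mollification -/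

section PreservesSpecial

variable {R : EReal} {f : ℝ → ℝ}

/-- The forms of `f` at `x + t i j` are nonnegative as soon as all the points lie in `[0, R)`. -/
theorem PreservesSpecial.forms_nonneg (h : PreservesSpecial R f) {m : ℕ} {x t : ℝ} (hx : 0 ≤ x)
    (ht : 0 ≤ t) (hR : ((x + t * (m * m : ℝ) : ℝ) : EReal) < R) (v : Fin (m + 1) → ℝ) :
    0 ≤ ∑ i, ∑ j, v i * v j * f (x + t * ((i : ℕ) * (j : ℕ))) := by
  have hst : √t * √t = t := Real.mul_self_sqrt ht
  have := h.sum_nonneg hx (u := fun i : Fin (m + 1) => √t * (i : ℕ))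
    (fun i => ⟨by positivity, lt_of_le_of_lt ?_ hR⟩) v
  · refine this.trans_eq (Finset.sum_congr rfl fun i _ => Finset.sum_congr rfl fun j _ => ?_)
    rw [mul_mul_mul_comm, hst]
  · have hi : ((i : ℕ) : ℝ) ≤ m := by exact_mod_cast Nat.lt_succ_iff.1 i.2
    rw [mul_pow, sq, sq, hst]
    exact_mod_cast (by gcongr : x + t * (((i : ℕ) : ℝ) * (i : ℕ)) ≤ x + t * (m * m))

theorem PreservesSpecial.iteratedDeriv_nonneg (h : PreservesSpecial R f) {x : ℝ}
    (hx : x ∈ intervalOO R) (hf : ContDiffAt ℝ ∞ f x) (m : ℕ) : 0 ≤ iteratedDeriv m f x := by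
  refine iteratedDeriv_nonneg_of_forms hf fun v => ?_
  obtain ⟨q, hxq, hqR⟩ := EReal.lt_iff_exists_real_btwn.1 hx.2
  have hxq : x < q := by exact_mod_cast hxq
  have hc : Tendsto (fun t : ℝ => x + t * (m * m)) (𝓝[>] 0) (𝓝 x) :=
    ((by fun_prop : Continuous fun t : ℝ => x + t * (m * m : ℝ)).tendsto' 0 x
      (by simp)).mono_left nhdsWithin_le_nhds
  filter_upwards [self_mem_nhdsWithin, hc.eventually (gt_mem_nhds hxq)] with t ht htq
  exact h.forms_nonneg hx.1.le (le_of_lt ht) (lt_trans (by exact_mod_cast htq) hqR) v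

-- Convolution with a nonnegative bump averages the forms over shifts of the base point, so the
-- mollified functions have nonnegative derivatives and Bernstein's theorem applies. They converge
-- to `f` by continuity.
open MeasureTheory in
theorem PreservesSpecial.hasNonnegSeriesOn (h : PreservesSpecial R f) {b q : ℝ} (hb : 0 < b)
    (hq : (q : EReal) < R) : HasNonnegSeriesOn f b q := by
  rcases le_or_gt q b with hqb | hbq
  · exact ⟨0, fun _ => le_rfl, fun x hx => absurd (hx.1.trans_lt hx.2) hqb.not_gt⟩
  obtain ⟨q', hqq', hqR⟩ := EReal.lt_iff_exists_real_btwn.1 hq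
  have hqq' : q < q' := by exact_mod_cast hqq'
  -- The order is `0 < p' < p < b < q < q'`: derivatives are controlled on `(p, q)`, and the margins
  -- to `p'` and `q'` absorb the shifts by the bump.
  obtain ⟨p, hp0, hpb⟩ := exists_between hb
  obtain ⟨p', hp0', hpp'⟩ := exists_between hp0
  have hpq' : p' ≤ q' := by linarith
  have hcont : ContinuousOn f (Icc p' q') := fun x hx =>
    (h.continuousAt ⟨hp0'.trans_le hx.1,
      lt_of_le_of_lt (by exact_mod_cast hx.2) hqR⟩).continuousWithinAt
  -- The constant extension makes the convolution globally defined; only values on `[p', q']`, where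
  -- it equals `f`, are used.
  set g : ℝ → ℝ := IccExtend hpq' ((Icc p' q').domRestrict f) with hg
  have hgc : Continuous g := hcont.domRestrict.Icc_extend'
  have hgf : ∀ x ∈ Icc p' q', g x = f x := fun x hx => by
    rw [hg, IccExtend_of_mem _ _ hx]; rfl
  let φ : ℕ → ContDiffBump (0 : ℝ) := fun n =>
    ⟨1 / (n + 1) / 2, 1 / (n + 1), by positivity, half_lt_self (by positivity)⟩
  have hφ : Tendsto (fun n => (φ n).rOut) atTop (𝓝 0) := tendsto_one_div_add_atTop_nhds_zero_nat
  let F : ℕ → ℝ → ℝ := fun n =>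
    convolution ((φ n).normed volume) g (ContinuousLinearMap.lsmul ℝ ℝ) volume
  have hFx : ∀ n x, F n x = ∫ s, (φ n).normed volume s * g (x - s) := fun n x => rfl
  have hFs : ∀ n, ContDiff ℝ ∞ (F n) := fun n =>
    (φ n).hasCompactSupport_normed.contDiff_convolution_left _ (φ n).contDiff_normed
      hgc.locallyIntegrable
  have hint : ∀ n x, Integrable (fun s => (φ n).normed volume s * g (x - s)) := fun n x =>
    (((φ n).continuous_normed).mul (by fun_prop)).integrable_of_hasCompactSupport
      ((φ n).hasCompactSupport_normed.mul_right)
  have hsmall : ∀ᶠ n in atTop, (φ n).rOut < min (p - p') (q' - q) :=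
    hφ.eventually (gt_mem_nhds (by simp only [lt_min_iff, sub_pos]; exact ⟨hpp', hqq'⟩))
  refine HasNonnegSeriesOn.of_tendsto (F := F) ?_ fun x hx => ?_
  · filter_upwards [hsmall] with n hn
    rw [lt_min_iff] at hn
    have hpos : ∀ k, ∀ y ∈ Ioo p q, 0 ≤ iteratedDeriv k (F n) y := by
      intro k y hy
      refine iteratedDeriv_nonneg_of_forms (hFs n).contDiffAt fun v => ?_
      have hc : Tendsto (fun t : ℝ => y + t * (k * k)) (𝓝[>] 0) (𝓝 y) :=
        ((by fun_prop : Continuous fun t : ℝ => y + t * (k * k : ℝ)).tendsto' 0 y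
          (by simp)).mono_left nhdsWithin_le_nhds
      filter_upwards [self_mem_nhdsWithin, hc.eventually (gt_mem_nhds hy.2)] with t ht htq
      replace ht : 0 < t := ht
      have hsum : ∑ i, ∑ j, v i * v j * F n (y + t * ((i : ℕ) * (j : ℕ))) =
          ∫ s, (φ n).normed volume s *
            ∑ i, ∑ j, v i * v j * g (y + t * ((i : ℕ) * (j : ℕ)) - s) := by
        have hint' : ∀ i j : Fin (k + 1), Integrable fun s => (φ n).normed volume s *
            (v i * v j * g (y + t * ((i : ℕ) * (j : ℕ)) - s)) := fun i j =>
          ((hint n _).const_mul (v i * v j)).congr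
            (Eventually.of_forall fun s => by simp only; ring)
        simp only [hFx, Finset.mul_sum, ← integral_const_mul]
        rw [integral_finsetSum _ fun i _ => integrable_finsetSum _ fun j _ => hint' i j]
        refine Finset.sum_congr rfl fun i _ => ?_
        rw [integral_finsetSum _ fun j _ => hint' i j]
        refine Finset.sum_congr rfl fun j _ => integral_congr_ae (Eventually.of_forall fun s => ?_)
        simp only
        ring
      rw [hsum]
      refine integral_nonneg fun s => ?_
      by_cases hs : s ∈ Metric.ball (0 : ℝ) (φ n).rOut
      · refine mul_nonneg ((φ n).nonneg_normed s) ?_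
        rw [Metric.mem_ball, Real.dist_eq, sub_zero, abs_lt] at hs
        have hforms := h.forms_nonneg (m := k) (x := y - s) (t := t)
          (by linarith [hy.1]) ht.le
          (lt_of_le_of_lt (by exact_mod_cast (by linarith : y - s + t * (k * k) ≤ q')) hqR) v
        refine hforms.trans_eq
          (Finset.sum_congr rfl fun i _ => Finset.sum_congr rfl fun j _ => ?_)
        have hi : ((i : ℕ) : ℝ) ≤ k := by exact_mod_cast Nat.lt_succ_iff.1 i.2
        have hj : ((j : ℕ) : ℝ) ≤ k := by exact_mod_cast Nat.lt_succ_iff.1 j.2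
        have h0 : 0 ≤ t * (((i : ℕ) : ℝ) * (j : ℕ)) := by positivity
        have h1 : t * (((i : ℕ) : ℝ) * (j : ℕ)) ≤ t * (k * k) := by gcongr
        rw [sub_add_eq_add_sub, hgf _ ⟨by linarith [hy.1], by linarith⟩]
      · have : (φ n).normed volume s = 0 := by
          rw [← Function.notMem_support, (φ n).support_normed_eq]
          exact hs
        simp [this]
    refine ⟨fun k => iteratedDeriv k (F n) b / k.factorial, fun k => ?_, fun x hx => ?_⟩
    · exact div_nonneg (hpos k b ⟨hpb, hbq⟩) (by positivity)
    · exact hasSum_taylor_of_nonneg (hFs n).contDiffOn hpos hpb hx.1 hx.2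
  · rw [← hgf x ⟨by linarith [hx.1], by linarith [hx.2]⟩]
    exact ContDiffBump.convolution_tendsto_right_of_continuous hφ hgc x

theorem isOpen_intervalOO (R : EReal) : IsOpen (intervalOO R) :=
  isOpen_Ioi.inter (isOpen_Iio.preimage continuous_coe_real_ereal)

theorem interior_intervalOO (R : EReal) : interior (intervalOO R) = intervalOO R :=
  (isOpen_intervalOO R).interior_eq

theorem interior_intervalCO (R : EReal) : interior (intervalCO R) = intervalOO R := by
  have : intervalCO R = Ici 0 ∩ Real.toEReal ⁻¹' Iio R := rfl
  rw [this, interior_inter, interior_Ici,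
    (isOpen_Iio.preimage continuous_coe_real_ereal).interior_eq]
  rfl

theorem PreservesSpecial.contDiffAt (h : PreservesSpecial R f) {x : ℝ}
    (hx : x ∈ intervalOO R) : ContDiffAt ℝ ∞ f x := by
  obtain ⟨q, hxq, hqR⟩ := EReal.lt_iff_exists_real_btwn.1 hx.2
  have hx0 : 0 < x := hx.1
  -- Expanding at `x / 2` puts `x` in the interior of the interval of convergence.
  exact (h.hasNonnegSeriesOn (half_pos hx0) hqR).contDiffAt
    ⟨half_lt_self hx0, by exact_mod_cast hxq⟩

theorem PreservesSpecial.absMonotonicOn (h : PreservesSpecial R f) :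
    AbsMonotonicOn f (intervalOO R) := by
  rw [AbsMonotonicOn, interior_intervalOO]
  exact ⟨fun x hx => (h.continuousAt hx).continuousWithinAt,
    fun x hx => (h.contDiffAt hx).contDiffWithinAt,
    fun k x hx => h.iteratedDeriv_nonneg hx (h.contDiffAt hx) k⟩

theorem PreservesSpecial.exists_tendsto (hR : 0 < R) (h : PreservesSpecial R f) :
    ∃ L : ℝ, Tendsto f (𝓝[>] 0) (𝓝 L) ∧ 0 ≤ f 0 ∧ f 0 ≤ L := by
  obtain ⟨q, h0q, hqR⟩ := EReal.lt_iff_exists_real_btwn.1 hR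
  have h0q : 0 < q := by exact_mod_cast h0q
  have h0 : (0 : ℝ) ∈ intervalCO R := ⟨le_rfl, by exact_mod_cast hR⟩
  have hmem : ∀ y ∈ Ioo 0 q, y ∈ intervalCO R := fun y hy =>
    ⟨hy.1.le, lt_trans (by exact_mod_cast hy.2) hqR⟩
  have hlim := (h.monotoneOn.mono hmem).tendsto_nhdsWithin_Ioo_right (nonempty_Ioo.2 h0q)
    ⟨f 0, by
      rintro _ ⟨y, hy, rfl⟩
      exact h.monotoneOn h0 (hmem y hy) hy.1.le⟩
  refine ⟨_, hlim, h.nonneg h0, ge_of_tendsto hlim ?_⟩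
  filter_upwards [Ioo_mem_nhdsGT h0q] with y hy
  exact h.monotoneOn h0 (hmem y hy) hy.1.le

end PreservesSpecial

/-! ### From absolute monotonicity to positive semidefiniteness -/

theorem posSemidef_map_pow {n : ℕ} {A : Matrix (Fin n) (Fin n) ℝ} (hA : A.PosSemidef) (k : ℕ) :
    (A.map (· ^ k)).PosSemidef := by
  induction k with
  | zero =>
    convert! posSemidef_vecMulVec_self_star (fun _ : Fin n => (1 : ℝ)) using 1
    ext i j
    simp [vecMulVec_apply]
  | succ k ih =>
    convert! ih.hadamard hA using 1

theorem specialMatrix_posSemidef {n : ℕ} {a : ℝ} (ha : 0 ≤ a) (u : Fin n → ℝ) :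
    (specialMatrix a u).PosSemidef := by
  refine Matrix.PosSemidef.add (Matrix.PosSemidef.smul ?_ ha) ?_
  · convert! posSemidef_vecMulVec_self_star (fun _ : Fin n => (1 : ℝ)) using 1
    ext i j
    simp [vecMulVec_apply]
  · simpa using posSemidef_vecMulVec_self_star u

theorem specialMatrix_mem {R : EReal} {n : ℕ} {a : ℝ} (ha : 0 ≤ a) {u : Fin n → ℝ}
    (hu : ∀ i, 0 ≤ u i ∧ ((a + u i ^ 2 : ℝ) : EReal) < R) (i j : Fin n) :
    specialMatrix a u i j ∈ intervalCO R := by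
  have hi := (hu i).1
  have hj := (hu j).1
  rw [specialMatrix_apply]
  refine ⟨by positivity, ?_⟩
  rcases le_total (u i) (u j) with hij | hij
  · exact lt_of_le_of_lt (by exact_mod_cast (by nlinarith : a + u i * u j ≤ a + u j ^ 2)) (hu j).2
  · exact lt_of_le_of_lt (by exact_mod_cast (by nlinarith : a + u i * u j ≤ a + u i ^ 2)) (hu i).2

section AbsMonotonicOn

variable {R : EReal} {f : ℝ → ℝ}

/-- Expanding at `ε` avoids the endpoint `0`, and shifting the argument by `ε` leaves powers of `x`
itself, that is, Hadamard powers of the original matrix. -/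
theorem AbsMonotonicOn.hasSum_taylor (hf : AbsMonotonicOn f (intervalOO R)) {ε x : ℝ}
    (hε : 0 < ε) (hx : 0 ≤ x) (hxR : ((x + ε : ℝ) : EReal) < R) :
    HasSum (fun k : ℕ => iteratedDeriv k f ε / k.factorial * x ^ k) (f (x + ε)) := by
  rw [AbsMonotonicOn, interior_intervalOO] at hf
  obtain ⟨q, hxq, hqR⟩ := EReal.lt_iff_exists_real_btwn.1 hxR
  have hsub : Ioo 0 q ⊆ intervalOO R := fun y hy =>
    ⟨hy.1, lt_trans (by exact_mod_cast hy.2) hqR⟩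
  have := hasSum_taylor_of_nonneg (hf.2.1.mono hsub) (fun k y hy => hf.2.2 k y (hsub hy)) hε
    (by linarith : ε ≤ x + ε) (by exact_mod_cast hxq)
  simpa only [add_sub_cancel_right] using this

theorem AbsMonotonicOn.le_of_le (hf : AbsMonotonicOn f (intervalOO R)) {x y : ℝ}
    (hx : 0 < x) (hxy : x ≤ y) (hy : (y : EReal) < R) : f x ≤ f y := by
  have h := hf.hasSum_taylor hx (sub_nonneg.2 hxy) (by simpa using hy)
  rw [sub_add_cancel] at h
  rw [AbsMonotonicOn, interior_intervalOO] at hf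
  have hxR : x ∈ intervalOO R := ⟨hx, lt_of_le_of_lt (by exact_mod_cast hxy) hy⟩
  have := le_hasSum h 0 fun k _ => mul_nonneg (div_nonneg (hf.2.2 k x hxR) (by positivity))
    (pow_nonneg (sub_nonneg.2 hxy) k)
  simpa using this

/-- The right limits of an absolutely monotone function at the entries of a positive semidefinite
matrix form a positive semidefinite matrix, even after subtracting a lower bound of the
function. -/
theorem AbsMonotonicOn.posSemidef_of_tendsto (hf : AbsMonotonicOn f (intervalOO R)) {d : ℝ}
    (hd : ∀ x ∈ intervalOO R, d ≤ f x) {n : ℕ} {A B : Matrix (Fin n) (Fin n) ℝ}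
    (hA : A.PosSemidef) (hAR : ∀ i j, A i j ∈ intervalCO R)
    (hlim : ∀ i j, Tendsto (fun ε => f (A i j + ε)) (𝓝[>] 0) (𝓝 (B i j))) :
    (Matrix.of fun i j => B i j - d).PosSemidef := by
  rw [posSemidef_iff_sum]
  have hsymm := ((posSemidef_iff_sum A).1 hA).1
  refine ⟨fun i j => ?_, fun v => ?_⟩
  · have h := hlim i j
    rw [hsymm i j] at h
    rw [Matrix.of_apply, Matrix.of_apply, tendsto_nhds_unique h (hlim j i)]
  rcases n with _ | n
  · simp
  have htend : Tendsto (fun ε => ∑ i, ∑ j, v i * v j * (f (A i j + ε) - d)) (𝓝[>] 0)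
      (𝓝 (∑ i, ∑ j, v i * v j * (B i j - d))) :=
    tendsto_finsetSum _ fun i _ => tendsto_finsetSum _ fun j _ =>
      ((hlim i j).sub_const d).const_mul _
  refine ge_of_tendsto htend ?_
  have hev : ∀ᶠ ε : ℝ in 𝓝[>] 0, ∀ i j, ((A i j + ε : ℝ) : EReal) < R := by
    refine eventually_all.2 fun i => eventually_all.2 fun j => ?_
    have hc : Tendsto (fun ε : ℝ => ((A i j + ε : ℝ) : EReal)) (𝓝[>] 0) (𝓝 (A i j : EReal)) :=
      ((continuous_coe_real_ereal.comp (continuous_const.add continuous_id)).tendsto' 0 _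
        (by simp)).mono_left nhdsWithin_le_nhds
    exact hc.eventually (gt_mem_nhds (hAR i j).2)
  filter_upwards [hev, self_mem_nhdsWithin] with ε hε hε0
  replace hε0 : 0 < ε := hε0
  have hεR : ε ∈ intervalOO R := ⟨hε0, lt_of_le_of_lt
    (by exact_mod_cast le_add_of_nonneg_left (hAR 0 0).1) (hε 0 0)⟩
  have hQ : ∀ k : ℕ, 0 ≤ ∑ i, ∑ j, v i * v j * A i j ^ k := fun k => by
    simpa using ((posSemidef_iff_sum _).1 (posSemidef_map_pow hA k)).2 v
  have hsum : HasSum (fun k : ℕ => iteratedDeriv k f ε / k.factorial *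
      ∑ i, ∑ j, v i * v j * A i j ^ k) (∑ i, ∑ j, v i * v j * f (A i j + ε)) := by
    have := hasSum_sum (s := Finset.univ) fun (i : Fin (n + 1)) _ =>
      hasSum_sum (s := Finset.univ) fun (j : Fin (n + 1)) _ =>
        (hf.hasSum_taylor hε0 (hAR i j).1 (hε i j)).mul_left (v i * v j)
    refine this.congr_fun fun k => ?_
    simp only [Finset.mul_sum]
    exact Finset.sum_congr rfl fun i _ => Finset.sum_congr rfl fun j _ => by ring
  have hder := hf.2.2
  rw [interior_intervalOO] at hder
  -- Keeping only the term `k = 0` leaves `f ε * (∑ i, v i) ^ 2`, which dominates `d * (∑ i, v i) ^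
  -- 2`.
  have h0 := le_hasSum hsum 0 fun k _ =>
    mul_nonneg (div_nonneg (hder k ε hεR) (by positivity)) (hQ k)
  have hQ0 := hQ 0
  simp only [pow_zero, mul_one, iteratedDeriv_zero, Nat.factorial_zero, Nat.cast_one, div_one]
    at h0 hQ0
  have h1 := mul_le_mul_of_nonneg_right (hd ε hεR) hQ0
  have h2 : ∑ i, ∑ j, v i * v j * (f (A i j + ε) - d) =
      ∑ i, ∑ j, v i * v j * f (A i j + ε) - d * ∑ i, ∑ j, v i * v j := by
    simp only [mul_sub, Finset.sum_sub_distrib, Finset.mul_sum]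
    simp only [mul_comm d]
  rw [h2]
  linarith

theorem AbsMonotonicOn.tendsto_add (hf : AbsMonotonicOn f (intervalOO R)) {x : ℝ}
    (hx : x ∈ intervalOO R) : Tendsto (fun ε => f (x + ε)) (𝓝[>] 0) (𝓝 (f x)) := by
  have h1 : ContinuousAt f x := hf.1.continuousAt ((isOpen_intervalOO R).mem_nhds hx)
  have h2 : Tendsto (fun ε : ℝ => x + ε) (𝓝[>] 0) (𝓝 x) :=
    ((continuous_const.add continuous_id).tendsto' 0 x (by simp)).mono_left nhdsWithin_le_nhds
  exact h1.tendsto.comp h2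

/-- If `a > 0`, all entries are positive and `f` is continuous there. If `a = 0`, let `B` be the
matrix of right limits and `e` the indicator of `u i ≠ 0`: then `f[u uᵀ]` is `f 0` times the
all-ones matrix plus the Hadamard product of `B - f 0` with `e eᵀ`. -/
theorem AbsMonotonicOn.preservesSpecial (hf : AbsMonotonicOn f (intervalOO R)) {L : ℝ}
    (hL : Tendsto f (𝓝[>] 0) (𝓝 L)) (h0 : 0 ≤ f 0) (h0L : f 0 ≤ L) : PreservesSpecial R f := by
  intro n _ a ha u hu
  have hA := specialMatrix_posSemidef ha.1 u
  have hmem := specialMatrix_mem ha.1 hu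
  have hlow : ∀ x ∈ intervalOO R, f 0 ≤ f x := fun x hx => by
    refine h0L.trans (le_of_tendsto hL ?_)
    filter_upwards [Ioo_mem_nhdsGT hx.1] with y hy
    exact hf.le_of_le hy.1 hy.2.le hx.2
  rcases ha.1.eq_or_lt with rfl | ha0
  · set B : Matrix (Fin n) (Fin n) ℝ :=
      Matrix.of fun i j => if u i * u j = 0 then L else f (u i * u j) with hB
    have hBpsd := hf.posSemidef_of_tendsto hlow hA hmem (B := B) fun i j => by
      simp only [specialMatrix_apply, zero_add, hB, Matrix.of_apply]
      split_ifs with hij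
      · simpa [hij] using hL
      · have hm := hmem i j
        rw [specialMatrix_apply, zero_add] at hm
        exact hf.tendsto_add ⟨lt_of_le_of_ne hm.1 (Ne.symm hij), hm.2⟩
    set e : Fin n → ℝ := fun i => if u i = 0 then 0 else 1 with he
    have hE : (vecMulVec e e).PosSemidef := by simpa using posSemidef_vecMulVec_self_star e
    have hone : (vecMulVec (fun _ : Fin n => (1 : ℝ)) (fun _ => 1)).PosSemidef := by
      simpa using posSemidef_vecMulVec_self_star (fun _ : Fin n => (1 : ℝ))
    convert! (hone.smul h0).add (hBpsd.hadamard hE) using 1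
    ext i j
    simp only [Matrix.map_apply, specialMatrix_apply, zero_add, Matrix.add_apply,
      Matrix.smul_apply, vecMulVec_apply, hadamard_apply, Matrix.of_apply, hB, he, smul_eq_mul]
    by_cases hi : u i = 0 <;> by_cases hj : u j = 0 <;> simp [hi, hj]
  · have := hf.posSemidef_of_tendsto (d := 0) (fun x hx => h0.trans (hlow x hx)) hA hmem
      (B := (specialMatrix a u).map f) fun i j => ?_
    · simp only [sub_zero] at this
      exact this
    · rw [Matrix.map_apply]
      refine hf.tendsto_add ⟨?_, (hmem i j).2⟩
      rw [specialMatrix_apply]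
      exact add_pos_of_pos_of_nonneg ha0 (mul_nonneg (hu i).1 (hu j).1)

theorem AbsMonotonicOn.mono_interior (hf : AbsMonotonicOn f (intervalCO R)) :
    AbsMonotonicOn f (intervalOO R) := by
  rw [AbsMonotonicOn, interior_intervalCO] at hf
  rw [AbsMonotonicOn, interior_intervalOO]
  exact ⟨hf.1.mono fun x hx => ⟨le_of_lt hx.1, hx.2⟩, hf.2⟩

theorem AbsMonotonicOn.preservesPSD (hf : AbsMonotonicOn f (intervalCO R)) :
    PreservesPSD (intervalCO R) f := by
  intro n _ A hA hmem
  have hnn : ∀ x ∈ intervalOO R, 0 ≤ f x := fun x hx => by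
    have := hf.2.2 0 x (by rwa [interior_intervalCO])
    simpa using this
  have := hf.mono_interior.posSemidef_of_tendsto hnn hA hmem (B := A.map f) fun i j => ?_
  · simp only [sub_zero] at this
    exact this
  · have hx := hmem i j
    have ht : Tendsto (fun ε : ℝ => A i j + ε) (𝓝[>] 0) (𝓝[intervalCO R] (A i j)) := by
      have hc : Tendsto (fun ε : ℝ => A i j + ε) (𝓝[>] 0) (𝓝 (A i j)) :=
        ((continuous_const.add continuous_id).tendsto' 0 _ (by simp)).mono_left
          nhdsWithin_le_nhds
      refine tendsto_nhdsWithin_iff.2 ⟨hc, ?_⟩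
      have hlt : ∀ᶠ ε : ℝ in 𝓝[>] 0, ((A i j + ε : ℝ) : EReal) < R :=
        hc.eventually ((isOpen_Iio.preimage continuous_coe_real_ereal).mem_nhds hx.2)
      filter_upwards [hlt, self_mem_nhdsWithin] with ε hε hε0
      exact ⟨add_nonneg hx.1 (le_of_lt hε0), hε⟩
    exact (hf.1 _ hx).tendsto.comp ht

/-! ### Continuity at zero and the equivalences -/

theorem PreservesPSD.preservesSpecial (h : PreservesPSD (intervalCO R) f) :
    PreservesSpecial R f := fun n hn _ ha u hu =>
  h n hn _ (specialMatrix_posSemidef ha.1 u) (specialMatrix_mem ha.1 hu)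

/-- The images of `ε * [[1, s, 0], [s, 1, s], [0, s, 1]]` tend to `[[L, L, f 0], [L, L, L], [f 0, L,
L]]`, whose determinant `-L * (L - f 0) ^ 2` signals that a jump is impossible. The vector `(1, -1,
t)` gives `L * t ^ 2 + 2 * (f 0 - L) * t`, which is nonnegative for all `t` only if `f 0 = L`. -/
theorem PreservesPSD.continuousWithinAt_zero (hR : 0 < R) (h : PreservesPSD (intervalCO R) f) :
    ContinuousWithinAt f (intervalCO R) 0 := by
  obtain ⟨L, hL, -, -⟩ := h.preservesSpecial.exists_tendsto hR
  obtain ⟨q, h0q, hqR⟩ := EReal.lt_iff_exists_real_btwn.1 hR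
  have h0q : 0 < q := by exact_mod_cast h0q
  -- The value `s = 1 / √2` is the largest for which the 3×3 matrix is positive semidefinite; its
  -- determinant is then zero.
  obtain ⟨s, hs0, hs2⟩ : ∃ s : ℝ, 0 < s ∧ s ^ 2 = 1 / 2 :=
    ⟨√(1 / 2), by positivity, Real.sq_sqrt (by norm_num)⟩
  have hs1 : s ≤ 1 := by nlinarith
  have hLs : Tendsto (fun ε => f (ε * s)) (𝓝[>] 0) (𝓝 L) := by
    refine hL.comp (tendsto_nhdsWithin_iff.2 ⟨?_, ?_⟩)
    · exact ((by fun_prop : Continuous fun ε : ℝ => ε * s).tendsto' 0 0 (by simp)).mono_left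
        nhdsWithin_le_nhds
    · filter_upwards [self_mem_nhdsWithin] with ε hε
      exact mul_pos hε hs0
  have key : ∀ t : ℝ, 0 ≤ L * (t * t) + 2 * (f 0 - L) * t + 0 := by
    intro t
    have hform : Tendsto (fun ε => f ε * (2 + t ^ 2) - 2 * f (ε * s) + 2 * t * f 0 -
        2 * t * f (ε * s)) (𝓝[>] 0) (𝓝 (L * (2 + t ^ 2) - 2 * L + 2 * t * f 0 - 2 * t * L)) :=
      (((hL.mul_const _).sub (hLs.const_mul 2)).add_const _).sub (hLs.const_mul _)
    have : 0 ≤ L * (2 + t ^ 2) - 2 * L + 2 * t * f 0 - 2 * t * L := by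
      refine ge_of_tendsto hform ?_
      filter_upwards [Ioo_mem_nhdsGT h0q] with ε hε
      have hmem : ∀ y, 0 ≤ y → y ≤ ε → y ∈ intervalCO R := fun y h0 hy =>
        ⟨h0, lt_trans (by exact_mod_cast hy.trans_lt hε.2) hqR⟩
      have hεs : ε * s ≤ ε := mul_le_of_le_one_right hε.1.le hs1
      have hεs0 : 0 ≤ ε * s := mul_nonneg hε.1.le hs0.le
      have hA : (!![ε, ε * s, 0; ε * s, ε, ε * s; 0, ε * s, ε] :
          Matrix (Fin 3) (Fin 3) ℝ).PosSemidef := by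
        rw [posSemidef_iff_sum]
        refine ⟨fun i j => by fin_cases i <;> fin_cases j <;> rfl, fun v => ?_⟩
        have h1 : ∑ i, ∑ j, v i * v j *
            (!![ε, ε * s, 0; ε * s, ε, ε * s; 0, ε * s, ε] : Matrix (Fin 3) (Fin 3) ℝ) i j =
            ε * ((v 1 + s * v 0 + s * v 2) ^ 2 + (v 0 - v 2) ^ 2 / 2) +
              ε * (1 / 2 - s ^ 2) * (v 0 + v 2) ^ 2 := by
          simp [Fin.sum_univ_three]
          ring
        rw [h1, hs2]
        have := hε.1
        simp only [sub_self, mul_zero, zero_mul, add_zero]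
        positivity
      have := ((posSemidef_iff_sum _).1 (h 3 (by norm_num) _ hA fun i j => by
        have := hε.1.le
        fin_cases i <;> fin_cases j <;> apply hmem <;> simp [*])).2 ![1, -1, t]
      simp [Fin.sum_univ_three] at this
      linarith
    linarith
  have hd := discrim_le_zero key
  have hf0 : f 0 = L := by
    rw [discrim] at hd
    nlinarith [sq_nonneg (f 0 - L)]
  have h1 : ContinuousWithinAt f (Ioi 0) 0 := by
    rw [ContinuousWithinAt, hf0]
    exact hL
  exact (continuousWithinAt_Ioi_iff_Ici.1 h1).mono fun x hx => hx.1

end AbsMonotonicOn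

/-- `f : [0, R) → ℝ` is represented by a function on `ℝ`; no condition below depends on its values
outside `[0, R)`. -/
theorem mainTheorem9 (R : EReal) (hR : 0 < R) (f : ℝ → ℝ) :
    (PreservesSpecial R f ↔
      AbsMonotonicOn f (intervalOO R) ∧
        ∃ L : ℝ, Tendsto f (𝓝[>] 0) (𝓝 L) ∧ 0 ≤ f 0 ∧ f 0 ≤ L) ∧
    List.TFAE
      [ContinuousWithinAt f (intervalCO R) 0 ∧ PreservesSpecial R f,
       PreservesPSD (intervalCO R) f,
       AbsMonotonicOn f (intervalCO R)] := by
  refine ⟨⟨fun h => ⟨h.absMonotonicOn, h.exists_tendsto hR⟩, ?_⟩, ?_⟩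
  · rintro ⟨hf, L, hL, h0, h0L⟩
    exact hf.preservesSpecial hL h0 h0L
  tfae_have 1 → 3 := by
    rintro ⟨hc, h⟩
    have hf := h.absMonotonicOn
    rw [AbsMonotonicOn, interior_intervalOO] at hf
    rw [AbsMonotonicOn, interior_intervalCO]
    refine ⟨fun x hx => ?_, hf.2⟩
    rcases hx.1.eq_or_lt with rfl | hx0
    · exact hc
    · exact (h.continuousAt ⟨hx0, hx.2⟩).continuousWithinAt
  tfae_have 3 → 2 := fun h => h.preservesPSD
  tfae_have 2 → 1 := fun h => ⟨h.continuousWithinAt_zero hR, h.preservesSpecial⟩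
  tfae_finish
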